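/- Let $m\ge 2$, let $U\subseteq\mathbb R^m$ be an open neighbourhood of $0$ and let $\psi=(P,Q):U\to\mathbb R^2$ be a real analytic map with $\psi(0)=0$ and with isolated critical point at the origin, in the sense that $D\psi(x)$ has rank $2$ for every $x\in U\setminus\{0\}$. Let $$\Psi:U\times\mathbb R\to\mathbb R,\qquad \Psi(x,\theta)=\cos(\theta)\,P(x)+\sin(\theta)\,Q(x)$$ be the Seade family of $\psi$, i.e. $\Psi(x,\theta)$ is the coordinate of the orthogonal projection of $\psi(x)$ to the line $L_\theta$ through the origin spanned by $(\cos\theta,\sin\theta)$. Put $$X=\Psi^{-1}(0)\setminus(\{0\}\times\mathbb R),\qquad Y=\{0\}\times\mathbb R,\qquad \rho:\mathbb R^m\times\mathbb R\to\mathbb R,\quad \rho(x,\theta)=\sum_{i=1}^m x_i^2 .$$ Suppose that the pair of strata $(X,Y)$ satisfies Bekka's $(c)$-regularity with respect to the control function $\rho$, that is: (i) $\rho^{-1}(0)=Y$; (ii) $\rho|_X$ is a submersion; (iii) whenever $(p_n)$ is a sequence of points of $X$ with $p_n\to y\in Y$ such that the subspaces $\ker d_{p_n}(\rho|_X)\subseteq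 T_{p_n}X$ converge (in the Grassmannian of linear subspaces of $\mathbb R^m\times\mathbb R$) to a subspace $\tau$, one has $T_yY\subseteq\tau$. Then $\psi$ satisfies the strong Milnor condition at the origin: there is $\varepsilon_0>0$ such that for every $0<\varepsilon\le\varepsilon_0$ the map $$\frac{\psi}{\|\psi\|}:S^{m-1}_\varepsilon\setminus K_\varepsilon\longrightarrow S^1,\qquad K_\varepsilon=\psi^{-1}(0)\cap S^{m-1}_\varepsilon,$$ where $S^{m-1}_\varepsilon$ is the sphere of radius $\varepsilon$ about $0$ in $\mathbb R^m$, is the (surjective) projection of a smooth locally trivial fibre bundle. -/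

import Mathlib

open scoped ContDiff Topology
open Filter

noncomputable section

namespace Milnor

/-! ### Smooth maps between subsets and smooth fibre bundles -/

section Smooth

variable {V V' : Type*} [NormedAddCommGroup V] [NormedSpace ℝ V]
  [NormedAddCommGroup V'] [NormedSpace ℝ V']

/-- `f` is smooth on the (arbitrary) subset `A` of a vector space: near every point of `A` it agrees
on `A` with a `C^∞` map defined on an open set. For embedded submanifolds `A` this is smoothness
in the sense of manifolds. -/
def IsSmoothOn (f : V → V') (A : Set V) : Prop :=
  ∀ a ∈ A, ∃ O : Set V, IsOpen O ∧ a ∈ O ∧ ∃ F : V → V', ContDiffOn ℝ ∞ F O ∧ Set.EqOn f F (A ∩ O)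

/-- `f` restricts to a diffeomorphism from the subset `A` onto the subset `B`. -/
def IsDiffeoOn (f : V → V') (A : Set V) (B : Set V') : Prop :=
  IsSmoothOn f A ∧ Set.MapsTo f A B ∧
    ∃ g : V' → V, IsSmoothOn g B ∧ Set.MapsTo g B A ∧ Set.InvOn g f A B

/-- `φ : A → B` is the projection of a smooth locally trivial fibre bundle: it is smooth and onto,
and every `b ∈ B` has a neighbourhood `B ∩ W` in `B` over which `φ` is smoothly trivial, the model
fibre being the fibre `A ∩ φ ⁻¹' {b}`. -/
def IsSmoothFibreBundle (φ : V → V') (A : Set V) (B : Set V') : Prop :=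
  IsSmoothOn φ A ∧ φ '' A = B ∧
    ∀ b ∈ B, ∃ W : Set V', IsOpen W ∧ b ∈ W ∧
      ∃ h : V' × V → V,
        IsDiffeoOn h ((B ∩ W) ×ˢ (A ∩ φ ⁻¹' {b})) (A ∩ φ ⁻¹' W) ∧
        ∀ w ∈ B ∩ W, ∀ x ∈ A ∩ φ ⁻¹' {b}, φ (h (w, x)) = w

end Smooth

/-! ### Bekka's `(c)`-regularity -/

section Bekka

variable {V : Type*} [NormedAddCommGroup V] [InnerProductSpace ℝ V] [FiniteDimensional ℝ V]

/-- The tangent space `T_p X`, a linear subspace of the ambient space, of an embedded submanifold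
`X` of `V` at `p ∈ X`. (For a submanifold the tangent cone already is a linear subspace.) -/
def tangentSpaceAt (X : Set V) (p : V) : Submodule ℝ V :=
  Submodule.span ℝ (tangentConeAt ℝ X p)

/-- The kernel of the differential `d_p (ρ|_X) : T_p X → ℝ`, as a subspace of `V`. -/
def kerDiffRestrict (ρ : V → ℝ) (X : Set V) (p : V) : Submodule ℝ V :=
  tangentSpaceAt X p ⊓ LinearMap.ker (fderiv ℝ ρ p : V →ₗ[ℝ] ℝ)

/-- Convergence in the Grassmannian of linear subspaces of `V`: a subspace is identified with the
orthogonal projection onto it. -/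
def SubspaceTendsto (K : ℕ → Submodule ℝ V) (τ : Submodule ℝ V) : Prop :=
  Tendsto (fun n => (K n).starProjection) atTop (𝓝 τ.starProjection)

/-- The pair of strata (smooth submanifolds) `(X, Y)` of `V` satisfies Bekka's `(c)`-regularity
with respect to the smooth non-negative control function `ρ`. -/
structure IsBekkaRegular (X Y : Set V) (ρ : V → ℝ) : Prop where
  smooth : ContDiff ℝ ∞ ρ
  nonneg : ∀ p, 0 ≤ ρ p
  zero_set : {p | ρ p = 0} = Y
  /-- `ρ|_X` is a submersion. -/
  submersion : ∀ p ∈ X, ∀ c : ℝ, ∃ v ∈ tangentSpaceAt X p, fderiv ℝ ρ p v = c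
  /-- Limits of the spaces `ker d_{x_n} (ρ|_X)` at a point `y ∈ Y` contain `T_y Y`. -/
  limit : ∀ (x : ℕ → V) (y : V) (τ : Submodule ℝ V), (∀ n, x n ∈ X) → y ∈ Y →
    Tendsto x atTop (𝓝 y) → SubspaceTendsto (fun n => kerDiffRestrict ρ X (x n)) τ →
    tangentSpaceAt Y y ≤ τ

end Bekka

/-! ### The Seade family and its strata -/

/-- `ℝ^m` with the Euclidean norm. -/
abbrev E (m : ℕ) := EuclideanSpace ℝ (Fin m)

/-- `ℝ^m × ℝ` with the Euclidean norm. -/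
abbrev Total (m : ℕ) := WithLp 2 (E m × ℝ)

/-- The Seade family `Ψ(x, θ) = π_θ (ψ x)`: the coordinate, with respect to the unit vector
`(cos θ, sin θ)`, of the orthogonal projection of `ψ x` to the line `L_θ` that it spans. -/
def seade {m : ℕ} (ψ : E m → E 2) (p : Total m) : ℝ :=
  inner ℝ (!₂[Real.cos p.snd, Real.sin p.snd] : E 2) (ψ p.fst)

/-- The stratum `X = Ψ⁻¹(0) \ ({0} × ℝ)`, for the map `ψ` with domain `U`. -/
def stratumX {m : ℕ} (ψ : E m → E 2) (U : Set (E m)) : Set (Total m) :=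
  {p | p.fst ∈ U ∧ seade ψ p = 0 ∧ p.fst ≠ 0}

/-- The stratum `Y = {0} × ℝ`. -/
def stratumY (m : ℕ) : Set (Total m) := {p | p.fst = 0}

/-- The control function `ρ(x, θ) = ∑ x_i ^ 2`. -/
def control (m : ℕ) (p : Total m) : ℝ := ∑ i, (p.fst i) ^ 2

/-! ### The strong Milnor condition -/

/-- The strong Milnor condition at the origin: for all sufficiently small `ε > 0`, the map
`ψ / ‖ψ‖ : S_ε^{m-1} \ K_ε → S^1`, where `K_ε = ψ⁻¹(0) ∩ S_ε^{m-1}`, is the projection of a smooth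
locally trivial fibre bundle. -/
def StrongMilnorCondition {m : ℕ} (ψ : E m → E 2) : Prop :=
  ∃ ε₀ : ℝ, 0 < ε₀ ∧ ∀ ε : ℝ, 0 < ε → ε ≤ ε₀ →
    IsSmoothFibreBundle (fun x => ‖ψ x‖⁻¹ • ψ x)
      (Metric.sphere (0 : E m) ε \ (ψ ⁻¹' {0} ∩ Metric.sphere (0 : E m) ε))
      (Metric.sphere (0 : E 2) 1)

end Milnor

end

/-!
The map `ψ / ‖ψ‖` on a small sphere `S` is trivialised by the flow of a vector field on `S` that
turns it at unit speed; `(c)`-regularity is what makes such a field exist.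

At a point `(x, θ)` of the stratum `X`, the kernel of `d(ρ|_X)` consists of pairs `(v, t)` with
`v ⟂ x` and `⟪(cos θ, sin θ), Dψ(x) v⟫ + t ⟪(-sin θ, cos θ), ψ x⟫ = 0`. Only the inclusion of the
tangent space of `X` in the kernel of `dΨ` is needed for what follows.

* If `ψ x = 0`, the second term disappears, and the submersion condition for all `θ` says that
  `Dψ(x)` maps the hyperplane `xᗮ` onto the plane (`exists_orthogonal_of_eq_zero`).
* If `ψ x ≠ 0` and `x` is a critical point of `ψ / ‖ψ‖` on its sphere, choose `θ` with
  `(cos θ, sin θ)` orthogonal to `ψ x`. The first term vanishes on `xᗮ`, so `t = 0` on the whole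
  kernel (`snd_eq_zero_of_mem_kerDiffRestrict`). Were there such points arbitrarily close to the
  origin, a limit of kernels would be contained in `ℝ^m × 0` and would not contain the tangent line
  of `0 × ℝ`. So there is a radius below which there are none (`exists_radius_orthogonal`).

On a sphere `S` of smaller radius both facts provide local tangential fields `g` such that
`⟪Jψ, Dψ g⟫ = ‖ψ‖²`, where `J` is the rotation by a right angle, and such that `g` vanishes on the
zero set `K` of `ψ`: near `K` one lifts the rotation field `Jψ` through `Dψ`. These conditions are
convex, so a partition of unity gives a global field (`exists_field`). Its flow preserves `S \ K`
for a uniform time although this set is not compact, because the points of `K` are fixed. Along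
the flow `ψ / ‖ψ‖` rotates at unit speed, and the flow for small times is a local trivialisation
(`isSmoothFibreBundle_normalize`).

That the flow depends smoothly on the initial point is proved by writing its trajectories as fixed
points of a smooth family of contractions of the Banach space `C([-1, 1], V)` and applying the
implicit function theorem (`exists_smooth_fixedPoint`, `exists_smooth_flow`). Composition with a
smooth map is smooth on that space (`contDiff_superposition`).
-/

noncomputable section

namespace Milnor

/-! ### Superposition operators on spaces of continuous maps -/

section Superposition

variable {I E F G : Type} [TopologicalSpace I] [CompactSpace I]
  [NormedAddCommGroup E] [NormedSpace ℝ E] [NormedAddCommGroup F] [NormedSpace ℝ F]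
  [NormedAddCommGroup G] [NormedSpace ℝ G]

/-- Pointwise application of a bounded bilinear map to continuous maps, as a bounded bilinear
map. -/
def pointwiseBilin (b : G →L[ℝ] E →L[ℝ] F) : C(I, G) →L[ℝ] C(I, E) →L[ℝ] C(I, F) :=
  LinearMap.mkContinuous₂
    (LinearMap.mk₂ ℝ (fun (A : C(I, G)) (u : C(I, E)) =>
      (⟨fun s => b (A s) (u s), by fun_prop⟩ : C(I, F)))
      (fun _ _ _ => by ext; simp) (fun _ _ _ => by ext; simp) (fun _ _ _ => by ext; simp)
      (fun _ _ _ => by ext; simp)) ‖b‖ fun A u => by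
    rw [ContinuousMap.norm_le _ (by positivity)]
    intro s
    exact b.le_of_opNorm₂_le_of_le le_rfl (A.norm_coe_le_norm s) (u.norm_coe_le_norm s)

theorem contDiff_pointwiseBilin {P : Type} [NormedAddCommGroup P] [NormedSpace ℝ P]
    {n : WithTop ℕ∞} (b : G →L[ℝ] E →L[ℝ] F) {f : P → C(I, G)} (hf : ContDiff ℝ n f) :
    ContDiff ℝ n (fun p => pointwiseBilin b (f p)) :=
  (pointwiseBilin (I := I) b).contDiff.comp hf

/-- The derivative of `u ↦ X ∘ u` is pointwise application of `DX ∘ u`. The uniform estimate comes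
from continuity of `u ↦ DX ∘ u` and the mean value inequality on balls of `E`. -/
theorem hasFDerivAt_superposition (b : G →L[ℝ] E →L[ℝ] F) (X : C(E, F)) (X' : C(E, G))
    (hX : ∀ x, HasFDerivAt X (b (X' x)) x) (u : C(I, E)) :
    HasFDerivAt (fun u : C(I, E) => X.comp u) (pointwiseBilin b (X'.comp u)) u := by
  rw [hasFDerivAt_iff_isLittleO_nhds_zero, Asymptotics.isLittleO_iff]
  intro c hc
  have hcont := (X'.continuous_postcomp (X := I)).tendsto u
  obtain ⟨η, hη, hball⟩ := Metric.tendsto_nhds_nhds.1 hcont (c / (‖b‖ + 1)) (by positivity)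
  filter_upwards [Metric.ball_mem_nhds (0 : C(I, E)) hη] with h hh
  rw [mem_ball_zero_iff] at hh
  rw [ContinuousMap.norm_le _ (by positivity)]
  intro s
  have hs : ‖h s‖ < η := (h.norm_coe_le_norm s).trans_lt hh
  have key := (convex_ball (u s) η).norm_image_sub_le_of_norm_hasFDerivWithin_le'
    (f := X) (f' := fun y => b (X' y)) (φ := b (X' (u s))) (C := c) (x := u s) (y := u s + h s)
    (fun y _ => (hX y).hasFDerivWithinAt) ?_ (Metric.mem_ball_self hη) (by simpa using hs)
  · have h1 : ‖X (u s + h s) - X (u s) - b (X' (u s)) (h s)‖ ≤ c * ‖h s‖ := by simpa using key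
    exact h1.trans (mul_le_mul_of_nonneg_left (h.norm_coe_le_norm s) hc.le)
  · intro y hy
    -- `y` is the value at `s` of a translate of `u` by a constant map.
    have hd : dist (u + ContinuousMap.const I (y - u s)) u < η := by
      rw [dist_eq_norm, add_sub_cancel_left, ContinuousMap.norm_lt_iff _ hη]
      intro _
      simpa [dist_eq_norm] using hy
    have h2 := (ContinuousMap.dist_apply_le_dist s).trans_lt (hball hd)
    rw [dist_eq_norm] at h2
    have h3 : ‖X' y - X' (u s)‖ ≤ c / (‖b‖ + 1) := by simpa using h2.le
    rw [← map_sub]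
    calc ‖b (X' y - X' (u s))‖ ≤ ‖b‖ * (c / (‖b‖ + 1)) := b.le_opNorm_of_le h3
      _ ≤ (‖b‖ + 1) * (c / (‖b‖ + 1)) := by gcongr; linarith
      _ = c := mul_div_cancel₀ _ (by positivity)

theorem contDiff_superposition_nat (n : ℕ) :
    ∀ {F : Type} [NormedAddCommGroup F] [NormedSpace ℝ F] (X : C(E, F)), ContDiff ℝ n X →
      ContDiff ℝ n (fun u : C(I, E) => X.comp u) := by
  induction n with
  | zero =>
    intro F _ _ X _
    exact contDiff_zero.2 X.continuous_postcomp
  | succ n ih =>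
    intro F _ _ X hX
    rw [Nat.cast_add, Nat.cast_one] at hX ⊢
    obtain ⟨X', hX', hd⟩ := contDiff_succ_iff_hasFDerivAt.1 hX
    exact contDiff_succ_iff_hasFDerivAt.2 ⟨fun u => pointwiseBilin (.id ℝ (E →L[ℝ] F))
      ((⟨X', hX'.continuous⟩ : C(E, E →L[ℝ] F)).comp u),
      contDiff_pointwiseBilin (.id ℝ (E →L[ℝ] F)) (ih ⟨X', hX'.continuous⟩ hX'),
      fun u => hasFDerivAt_superposition (.id ℝ (E →L[ℝ] F)) X ⟨X', hX'.continuous⟩ hd u⟩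

/-- Composition with a smooth map is a smooth map between spaces of continuous maps. -/
theorem contDiff_superposition (X : C(E, F)) (hX : ContDiff ℝ ∞ X) :
    ContDiff ℝ ∞ (fun u : C(I, E) => X.comp u) :=
  contDiff_infty.2 fun n => contDiff_superposition_nat n X (contDiff_infty.1 hX n)

end Superposition

/-! ### Fixed points depending smoothly on parameters -/

/-- The fixed point of a smooth family of contractions of a Banach space depends smoothly on the
parameter: the partial derivative has norm less than one, so the implicit function theorem applies
to `u - g (p, u) = 0`. -/
theorem exists_smooth_fixedPoint {P B : Type} [NormedAddCommGroup P] [NormedSpace ℝ P]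
    [CompleteSpace P] [NormedAddCommGroup B] [NormedSpace ℝ B] [CompleteSpace B]
    {g : P × B → B} (hg : ContDiff ℝ ∞ g)
    {c : P → NNReal} (hc : Continuous c) (hlip : ∀ p, LipschitzWith (c p) (fun u => g (p, u))) :
    ∃ sol : P → B, (∀ p, c p < 1 → ∀ u, g (p, u) = u ↔ u = sol p) ∧
      ∀ p, c p < 1 → ContDiffAt ℝ ∞ sol p := by
  have hex : ∀ p, ∃ v, c p < 1 → ∀ u, g (p, u) = u ↔ u = v := by
    intro p
    by_cases hp : c p < 1
    · have hcon : ContractingWith (c p) (fun u => g (p, u)) := ⟨hp, hlip p⟩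
      refine ⟨hcon.fixedPoint, fun _ u => ⟨fun h => hcon.fixedPoint_unique h, ?_⟩⟩
      rintro rfl
      exact hcon.fixedPoint_isFixedPt
    · exact ⟨0, fun h => absurd h hp⟩
  choose sol hsol using hex
  refine ⟨sol, hsol, fun p hp => ?_⟩
  have hF : ContDiff ℝ ∞ (fun q : P × B => q.2 - g q) := contDiff_snd.sub hg
  have hinv : (fderiv ℝ (fun q : P × B => q.2 - g q) (p, sol p) ∘L .inr ℝ P B).IsInvertible := by
    have hd : HasFDerivAt (fun u => g (p, u)) (fderiv ℝ (fun u => g (p, u)) (sol p)) (sol p) :=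
      ((hg.comp (contDiff_prodMk_right p)).differentiable (by simp) (sol p)).hasFDerivAt
    have hlt : ‖fderiv ℝ (fun u => g (p, u)) (sol p)‖ < 1 :=
      (norm_fderiv_le_of_lipschitz ℝ (hlip p)).trans_lt (by exact_mod_cast hp)
    have hd' := ((hF.differentiable (by simp) (p, sol p)).hasFDerivAt).comp (sol p)
      (hasFDerivAt_prodMk_right p (sol p))
    have heq := hd'.unique ((hasFDerivAt_id (sol p)).sub hd)
    rw [heq]
    exact ⟨ContinuousLinearEquiv.ofUnit (Units.oneSub _ hlt), rfl⟩
  refine (hF.contDiffAt.contDiffAt_implicitFunction (by simp) hinv).congr_of_eventuallyEq ?_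
  filter_upwards [hc.continuousAt.eventually_lt_const hp,
    hF.contDiffAt.eventually_apply_implicitFunction (by simp) hinv] with q hq h
  rw [(hsol p hp _).2 rfl, sub_self] at h
  exact ((hsol q hq _).1 (sub_eq_zero.1 h).symm).symm

/-! ### The flow of a smooth Lipschitz vector field -/

section Flow

variable {E : Type} [NormedAddCommGroup E] [NormedSpace ℝ E]

/-- The extension of a path on `[-1, 1]` to the line, constant outside the interval. -/
def pathExtend (u : C(Set.Icc (-1 : ℝ) 1, E)) : C(ℝ, E) :=
  u.comp ⟨Set.projIcc (-1) 1 (by norm_num), continuous_projIcc⟩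

omit [NormedSpace ℝ E] in
theorem pathExtend_coe (u : C(Set.Icc (-1 : ℝ) 1, E)) (s : Set.Icc (-1 : ℝ) 1) :
    pathExtend u s = u s := by
  simp [pathExtend]

theorem norm_integral_pathExtend_le (u : C(Set.Icc (-1 : ℝ) 1, E)) (s : Set.Icc (-1 : ℝ) 1) :
    ‖∫ r in (0 : ℝ)..s, pathExtend u r‖ ≤ ‖u‖ := by
  refine (intervalIntegral.norm_integral_le_of_norm_le_const (C := ‖u‖)
    fun r _ => u.norm_coe_le_norm _).trans ?_
  rw [sub_zero]
  exact mul_le_of_le_one_right (norm_nonneg _) (abs_le.2 s.2)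

/-- The Volterra operator `u ↦ (s ↦ ∫ r in 0..s, u r)` on paths over `[-1, 1]`. -/
def volterra : C(Set.Icc (-1 : ℝ) 1, E) →L[ℝ] C(Set.Icc (-1 : ℝ) 1, E) :=
  LinearMap.mkContinuous
    { toFun := fun u => ⟨fun s => ∫ r in (0 : ℝ)..s, pathExtend u r,
        (intervalIntegral.continuous_primitive
          (fun _ _ => (pathExtend u).continuous.intervalIntegrable _ _) 0).comp
          continuous_subtype_val⟩
      map_add' := fun u v => by
        ext s
        exact intervalIntegral.integral_add ((pathExtend u).continuous.intervalIntegrable _ _)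
          ((pathExtend v).continuous.intervalIntegrable _ _)
      map_smul' := fun c u => by
        ext s
        exact intervalIntegral.integral_smul c _ } 1 fun u => by
    rw [one_mul, ContinuousMap.norm_le _ (norm_nonneg _)]
    exact norm_integral_pathExtend_le u

theorem norm_volterra_le (u : C(Set.Icc (-1 : ℝ) 1, E)) : ‖volterra u‖ ≤ ‖u‖ := by
  rw [ContinuousMap.norm_le _ (norm_nonneg _)]
  exact norm_integral_pathExtend_le u

theorem dist_volterra_le (u v : C(Set.Icc (-1 : ℝ) 1, E)) :
    dist (volterra u) (volterra v) ≤ dist u v := by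
  rw [dist_eq_norm, dist_eq_norm, ← map_sub]
  exact norm_volterra_le _

/-- The Picard operator whose fixed points are the solutions of `u' = T • X u`, `u 0 = x`,
over `[-1, 1]`, where `p = (T, x)`. -/
def picardMap (X : C(E, E)) (p : ℝ × E) (u : C(Set.Icc (-1 : ℝ) 1, E)) :
    C(Set.Icc (-1 : ℝ) 1, E) :=
  ContinuousMap.const _ p.2 + p.1 • volterra (X.comp u)

theorem contDiff_picardMap (X : C(E, E)) (hX : ContDiff ℝ ∞ X) :
    ContDiff ℝ ∞ (fun q : (ℝ × E) × C(Set.Icc (-1 : ℝ) 1, E) => picardMap X q.1 q.2) := by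
  have h1 : ContDiff ℝ ∞ (fun q : (ℝ × E) × C(Set.Icc (-1 : ℝ) 1, E) =>
      ContinuousMap.const (Set.Icc (-1 : ℝ) 1) q.1.2) := by
    let c : E →L[ℝ] C(Set.Icc (-1 : ℝ) 1, E) :=
      LinearMap.mkContinuous
        { toFun := fun x => ContinuousMap.const _ x
          map_add' := fun _ _ => rfl
          map_smul' := fun _ _ => rfl } 1 fun x => by
        rw [one_mul, ContinuousMap.norm_le _ (by positivity)]
        intro s
        exact le_rfl
    exact c.contDiff.comp contDiff_fst.snd
  exact h1.add (contDiff_fst.fst.smul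
    (volterra.contDiff.comp ((contDiff_superposition X hX).comp contDiff_snd)))

omit [NormedSpace ℝ E] in
theorem lipschitzWith_superposition {I : Type} [TopologicalSpace I] [CompactSpace I]
    (X : C(E, E)) {K : NNReal} (hK : LipschitzWith K X) :
    LipschitzWith K (fun u : C(I, E) => X.comp u) := by
  refine LipschitzWith.of_dist_le_mul fun u v => ?_
  rw [ContinuousMap.dist_le (by positivity)]
  intro s
  exact (hK.dist_le_mul (u s) (v s)).trans
    (mul_le_mul_of_nonneg_left (ContinuousMap.dist_apply_le_dist s) K.2)

theorem lipschitzWith_picardMap (X : C(E, E)) {K : NNReal} (hK : LipschitzWith K X) (p : ℝ × E) :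
    LipschitzWith (‖p.1‖₊ * K) (picardMap X p) := by
  refine LipschitzWith.of_dist_le_mul fun u v => ?_
  have h2 : dist (volterra (X.comp u)) (volterra (X.comp v)) ≤ K * dist u v :=
    (dist_volterra_le _ _).trans ((lipschitzWith_superposition X hK).dist_le_mul u v)
  rw [ContinuousMap.dist_le (by positivity), NNReal.coe_mul, coe_nnnorm, mul_assoc]
  intro s
  change dist (p.2 + p.1 • volterra (X.comp u) s) (p.2 + p.1 • volterra (X.comp v) s) ≤ _
  rw [dist_add_left, dist_smul₀]
  exact mul_le_mul_of_nonneg_left ((ContinuousMap.dist_apply_le_dist s).trans h2) (norm_nonneg _)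

/-- A smooth Lipschitz vector field on a Banach space has a smooth flow, defined for a uniform
time. The flow at time `t` is the value at time `1` of the solution for the field `t • X`; rescaling
paths shows that this is an integral curve as a function of `t`. -/
theorem exists_smooth_flow [CompleteSpace E] {X : E → E} (hX : ContDiff ℝ ∞ X) {K : NNReal}
    (hK : LipschitzWith K X) :
    ∃ δ : ℝ, 0 < δ ∧ ∃ Φ : ℝ × E → E, ContDiffOn ℝ ∞ Φ (Set.Ioo (-δ) δ ×ˢ Set.univ) ∧
      (∀ x, Φ (0, x) = x) ∧
      ∀ x, ∀ t ∈ Set.Ioo (-δ) δ, HasDerivAt (fun s => Φ (s, x)) (X (Φ (t, x))) t := by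
  obtain ⟨sol, hsol, hsm⟩ := exists_smooth_fixedPoint
    (contDiff_picardMap ⟨X, hX.continuous⟩ hX) (c := fun p => ‖p.1‖₊ * K) (by fun_prop)
    (lipschitzWith_picardMap ⟨X, hX.continuous⟩ hK)
  simp only [← NNReal.coe_lt_coe, NNReal.coe_mul, coe_nnnorm, NNReal.coe_one] at hsol hsm
  have hδ : (0 : ℝ) < 1 / (K + 1) := by positivity
  have hlt : ∀ t : ℝ, |t| < 1 / (K + 1) → ‖t‖ * K < 1 := by
    intro t ht
    rw [lt_div_iff₀ (by positivity)] at ht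
    rw [Real.norm_eq_abs]
    nlinarith [abs_nonneg t]
  let one : Set.Icc (-1 : ℝ) 1 := ⟨1, by norm_num⟩
  have happ : ∀ p : ℝ × E, ‖p.1‖ * K < 1 → ∀ s, sol p s =
      p.2 + p.1 • ∫ r in (0 : ℝ)..s, X (pathExtend (sol p) r) := by
    intro p hp s
    conv_lhs => rw [← (hsol p hp _).2 rfl]
    rfl
  -- Rescaling time turns the solution for `T • X` into the one for `(s * T) • X`.
  have hscale : ∀ (T : ℝ) (x : E), |T| < 1 / (K + 1) → ∀ s : Set.Icc (-1 : ℝ) 1,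
      sol (s * T, x) one = sol (T, x) s := by
    intro T x hT s
    have hsT : |(s : ℝ) * T| < 1 / (K + 1) := by
      rw [abs_mul]
      exact (mul_le_of_le_one_left (abs_nonneg T) (abs_le.2 s.2)).trans_lt hT
    have hmem : ∀ r : Set.Icc (-1 : ℝ) 1, (s : ℝ) * r ∈ Set.Icc (-1 : ℝ) 1 := fun r =>
      abs_le.1 (by rw [abs_mul]; exact mul_le_one₀ (abs_le.2 s.2) (abs_nonneg _) (abs_le.2 r.2))
    let v : C(Set.Icc (-1 : ℝ) 1, E) := (sol (T, x)).comp ⟨fun r => ⟨s * r, hmem r⟩, by fun_prop⟩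
    have hv : v = sol (s * T, x) := by
      refine (hsol (s * T, x) (hlt _ hsT) v).1 ?_
      ext r
      have h1 : v r = x + T • ∫ r' in (0 : ℝ)..(s * r), X (pathExtend (sol (T, x)) r') :=
        happ (T, x) (hlt _ hT) ⟨s * r, hmem r⟩
      rw [h1]
      change x + ((s : ℝ) * T) • ∫ r' in (0 : ℝ)..r, X (pathExtend v r') = _
      congr 1
      rw [mul_comm, mul_smul]
      congr 1
      have h2 : ∫ r' in (0 : ℝ)..r, X (pathExtend v r') =
          ∫ r' in (0 : ℝ)..r, X (pathExtend (sol (T, x)) (s * r')) := by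
        refine intervalIntegral.integral_congr fun r' hr' => ?_
        have hr'' : r' ∈ Set.Icc (-1 : ℝ) 1 := by
          have h0 : (0 : ℝ) ∈ Set.Icc (-1 : ℝ) 1 := by norm_num
          exact (Set.uIcc_subset_Icc h0 r.2) hr'
        have h3 := pathExtend_coe v ⟨r', hr''⟩
        have h4 := pathExtend_coe (sol (T, x)) ⟨s * r', hmem ⟨r', hr''⟩⟩
        simp only at h3 h4
        change X _ = X _
        rw [h3, h4]
        rfl
      rw [h2, intervalIntegral.smul_integral_comp_mul_left
        (fun r' => X (pathExtend (sol (T, x)) r')), mul_zero]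
    rw [← hv]
    change sol (T, x) _ = _
    congr 1
    ext
    simp [one]
  refine ⟨1 / (K + 1), hδ, fun p => sol p one, ?_, ?_, ?_⟩
  · rintro ⟨t, x⟩ ⟨ht, -⟩
    have h := hsm (t, x) (hlt t (abs_lt.2 ht))
    exact (((ContinuousMap.evalCLM ℝ one).contDiff.contDiffAt).comp (t, x) h).contDiffWithinAt
  · intro x
    change sol (0, x) one = x
    rw [happ (0, x) (by simp)]
    simp
  · intro x t ht
    obtain ⟨T, hT0, hT⟩ := exists_between (abs_lt.2 ht)
    have hTpos : 0 < T := (abs_nonneg t).trans_lt hT0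
    have hTabs : |T| < 1 / (K + 1) := by rwa [abs_of_pos hTpos]
    have hnear : ∀ s ∈ Set.Ioo (-T) T, sol (s, x) one =
        x + T • ∫ r in (0 : ℝ)..(s / T), X (pathExtend (sol (T, x)) r) := by
      intro s hs
      have hmem : s / T ∈ Set.Icc (-1 : ℝ) 1 :=
        ⟨by rw [le_div_iff₀ hTpos]; linarith [hs.1], by rw [div_le_iff₀ hTpos]; linarith [hs.2]⟩
      have h := hscale T x hTabs ⟨s / T, hmem⟩
      simp only [div_mul_cancel₀ s hTpos.ne'] at h
      rw [h, happ (T, x) (hlt _ hTabs)]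
    have hval : sol (t, x) one = pathExtend (sol (T, x)) (t / T) := by
      have hmem : t / T ∈ Set.Icc (-1 : ℝ) 1 := by
        have := abs_lt.1 hT0
        exact ⟨by rw [le_div_iff₀ hTpos]; linarith, by rw [div_le_iff₀ hTpos]; linarith⟩
      have h := hscale T x hTabs ⟨t / T, hmem⟩
      simp only [div_mul_cancel₀ t hTpos.ne'] at h
      rw [h, ← pathExtend_coe]
    have hcont : Continuous fun r => X (pathExtend (sol (T, x)) r) :=
      hX.continuous.comp (pathExtend _).continuous
    have hI := (hcont.integral_hasStrictDerivAt 0 (t / T)).hasDerivAt.scomp t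
      ((hasDerivAt_id t).div_const T)
    have hD := (hI.const_smul T).const_add x
    rw [smul_smul, mul_one_div_cancel hTpos.ne', one_smul] at hD
    change HasDerivAt (fun s => sol (s, x) one) (X (sol (t, x) one)) t
    rw [hval]
    refine hD.congr_of_eventuallyEq ?_
    filter_upwards [Ioo_mem_nhds (abs_lt.1 hT0).1 (abs_lt.1 hT0).2] with s hs
    exact hnear s hs

end Flow

/-! ### The plane: rotation by a right angle and polar coordinates -/

theorem inner_plane (v w : E 2) : inner ℝ v w = v 0 * w 0 + v 1 * w 1 := by
  simp [PiLp.inner_apply, Fin.sum_univ_two, mul_comm]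

/-- Rotation of the plane by a right angle. -/
def quarterTurn : E 2 →L[ℝ] E 2 :=
  LinearMap.toContinuousLinearMap
    { toFun := fun w => !₂[-w 1, w 0]
      map_add' := fun v w => by ext i; fin_cases i <;> simp [add_comm]
      map_smul' := fun c w => by ext i; fin_cases i <;> simp }

@[simp] theorem quarterTurn_zero (w : E 2) : quarterTurn w 0 = -w 1 := rfl
@[simp] theorem quarterTurn_one (w : E 2) : quarterTurn w 1 = w 0 := rfl

theorem quarterTurn_quarterTurn (w : E 2) : quarterTurn (quarterTurn w) = -w := by
  ext i; fin_cases i <;> simp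

theorem norm_sq_plane (w : E 2) : ‖w‖ ^ 2 = w 0 ^ 2 + w 1 ^ 2 := by
  rw [← real_inner_self_eq_norm_sq, inner_plane]; ring

theorem norm_quarterTurn (w : E 2) : ‖quarterTurn w‖ = ‖w‖ := by
  rw [← sq_eq_sq₀ (norm_nonneg _) (norm_nonneg _), norm_sq_plane, norm_sq_plane]
  simp [add_comm]

/-- The unit vector of angle `θ`. -/
def unitVector (θ : ℝ) : E 2 := !₂[Real.cos θ, Real.sin θ]

theorem hasDerivAt_unitVector (θ : ℝ) :
    HasDerivAt unitVector (quarterTurn (unitVector θ)) θ := by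
  have h : unitVector = fun θ => Real.cos θ • (!₂[1, 0] : E 2) + Real.sin θ • (!₂[0, 1] : E 2) := by
    ext θ i; fin_cases i <;> simp [unitVector]
  have h' : quarterTurn (unitVector θ) =
      -Real.sin θ • (!₂[1, 0] : E 2) + Real.cos θ • (!₂[0, 1] : E 2) := by
    ext i; fin_cases i <;> simp [unitVector]
  rw [h', h]
  exact ((Real.hasDerivAt_cos θ).smul_const _).add ((Real.hasDerivAt_sin θ).smul_const _)

theorem exists_eq_norm_smul_unitVector (n : E 2) :
    ∃ θ ∈ Set.Icc (-Real.pi) Real.pi, n = ‖n‖ • unitVector θ := by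
  let z : ℂ := ⟨n 0, n 1⟩
  have hz : ‖z‖ = ‖n‖ := by
    rw [← sq_eq_sq₀ (norm_nonneg _) (norm_nonneg _), norm_sq_plane, Complex.sq_norm,
      Complex.normSq_apply]
    ring
  refine ⟨z.arg, ⟨(Complex.neg_pi_lt_arg z).le, Complex.arg_le_pi z⟩, ?_⟩
  rw [← hz]
  ext i
  fin_cases i
  · exact (Complex.norm_mul_cos_arg z).symm
  · exact (Complex.norm_mul_sin_arg z).symm

/-! ### Tangent spaces of the strata -/

theorem hasFDerivAt_seade {m : ℕ} {ψ : E m → E 2} {p : Total m}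
    (hψ : DifferentiableAt ℝ ψ p.fst) :
    ∃ D : Total m →L[ℝ] ℝ, HasFDerivAt (seade ψ) D p ∧ ∀ v : Total m, D v =
      inner ℝ (unitVector p.snd) (fderiv ℝ ψ p.fst v.fst) +
        v.snd * inner ℝ (quarterTurn (unitVector p.snd)) (ψ p.fst) := by
  let F : Total m →L[ℝ] E m := WithLp.fstL 2 ℝ (E m) ℝ
  let S : Total m →L[ℝ] ℝ := WithLp.sndL 2 ℝ (E m) ℝ
  have h1 : HasFDerivAt (fun q : Total m => ψ q.fst) (fderiv ℝ ψ p.fst ∘L F) p :=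
    HasFDerivAt.comp (g := ψ) p hψ.hasFDerivAt F.hasFDerivAt
  have h2 := HasFDerivAt.comp (g := unitVector) p (hasDerivAt_unitVector p.snd).hasFDerivAt
    S.hasFDerivAt
  refine ⟨_, h2.inner ℝ h1, fun v => ?_⟩
  simp [real_inner_smul_left, F, S]

theorem eq_zero_of_mem_tangentSpaceAt {V : Type*} [NormedAddCommGroup V] [InnerProductSpace ℝ V]
    [FiniteDimensional ℝ V] {f : V → ℝ} {D : V →L[ℝ] ℝ} {X : Set V} {p v : V}
    (hD : HasFDerivAt f D p) (hX : ∀ q ∈ X, f q = 0) (hp : p ∈ X)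
    (hv : v ∈ tangentSpaceAt X p) : D v = 0 := by
  have hle : tangentSpaceAt X p ≤ LinearMap.ker (D : V →ₗ[ℝ] ℝ) := by
    refine Submodule.span_le.2 fun w hw => ?_
    have h := hD.hasFDerivWithinAt.mapsTo_tangent_cone hw
    have hsub : f '' X ⊆ {0} := by rintro _ ⟨q, hq, rfl⟩; exact hX q hq
    refine tangentConeAt_subset_zero (fun hacc => ?_) h
    rw [hX p hp, accPt_iff_frequently] at hacc
    obtain ⟨y, hy0, hy⟩ := hacc.exists
    exact hy0 (hsub hy)
  exact hle hv

theorem fderiv_norm_sq_comp {V W : Type*} [NormedAddCommGroup V] [NormedSpace ℝ V]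
    [NormedAddCommGroup W] [InnerProductSpace ℝ W] (F : V →L[ℝ] W) (p v : V) :
    fderiv ℝ (fun q => ‖F q‖ ^ 2) p v = 2 * inner ℝ (F p) (F v) := by
  rw [F.hasFDerivAt.norm_sq.fderiv]
  simp

theorem fderiv_control {m : ℕ} (p v : Total m) :
    fderiv ℝ (control m) p v = 2 * inner ℝ p.fst v.fst := by
  have h : control m = fun q => ‖WithLp.fstL 2 ℝ (E m) ℝ q‖ ^ 2 := by
    ext q
    exact (EuclideanSpace.real_norm_sq_eq q.fst).symm
  rw [h]
  exact fderiv_norm_sq_comp _ p v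

theorem sub_mem_tangentSpaceAt {V : Type*} [NormedAddCommGroup V] [InnerProductSpace ℝ V]
    [FiniteDimensional ℝ V] {Y : Set V} {x y : V} (h : segment ℝ x y ⊆ Y) :
    y - x ∈ tangentSpaceAt Y x :=
  Submodule.subset_span (mem_tangentConeAt_of_segment_subset h)

theorem mem_tangentSpaceAt_stratumY {m : ℕ} (θ : ℝ) :
    (WithLp.toLp 2 ((0 : E m), (1 : ℝ)) : Total m) ∈
      tangentSpaceAt (stratumY m) (WithLp.toLp 2 ((0 : E m), θ)) := by
  have h : (WithLp.toLp 2 ((0 : E m), (1 : ℝ)) : Total m) =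
      WithLp.toLp 2 ((0 : E m), θ + 1) - WithLp.toLp 2 ((0 : E m), θ) := by
    rw [← WithLp.toLp_sub]
    simp
  rw [h]
  refine sub_mem_tangentSpaceAt ?_
  rintro _ ⟨a, b, _, _, _, rfl⟩
  change a • (0 : E m) + b • (0 : E m) = 0
  simp

/-! ### Transversality from `(c)`-regularity -/

section Transversality

variable {m : ℕ} {U : Set (E m)} {ψ : E m → E 2}

/-- Away from the origin, the zero set of `ψ` is transverse to the spheres: this is the submersion
condition, applied at a zero `x` of `ψ` for every angle `θ`. -/
theorem exists_orthogonal_of_eq_zero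
    (hdiff : ∀ x ∈ U, DifferentiableAt ℝ ψ x)
    (hcrit : ∀ x ∈ U, x ≠ 0 → Function.Surjective (fderiv ℝ ψ x))
    (hc : IsBekkaRegular (stratumX ψ U) (stratumY m) (control m))
    {x : E m} (hxU : x ∈ U) (hx : x ≠ 0) (hψx : ψ x = 0) {n : E 2} (hn : n ≠ 0) :
    ∃ v, inner ℝ x v = 0 ∧ inner ℝ n (fderiv ℝ ψ x v) ≠ 0 := by
  obtain ⟨θ, -, hθ⟩ := exists_eq_norm_smul_unitVector n
  by_contra! hcon
  let p : Total m := WithLp.toLp 2 (x, θ)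
  have hp : p ∈ stratumX ψ U := ⟨hxU, by simp [seade, p, hψx], hx⟩
  obtain ⟨D, hD, hDv⟩ := hasFDerivAt_seade (p := p) (hdiff x hxU)
  obtain ⟨w, hw, hw1⟩ := hc.submersion p hp 1
  have h0 := eq_zero_of_mem_tangentSpaceAt hD (fun q hq => hq.2.1) hp hw
  rw [hDv] at h0
  rw [fderiv_control] at hw1
  have h1 : inner ℝ n (fderiv ℝ ψ x w.fst) = 0 := by
    have h2 : inner ℝ (unitVector θ) (fderiv ℝ ψ x w.fst) = 0 := by
      simpa [p, hψx] using h0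
    rw [hθ, real_inner_smul_left, h2, mul_zero]
  have hw2 : inner ℝ x w.fst ≠ 0 := fun h => by
    have : (2 : ℝ) * inner ℝ x w.fst = 1 := hw1
    rw [h] at this
    norm_num at this
  obtain ⟨v, hv⟩ := hcrit x hxU hx n
  -- Correct `v` by a multiple of `w` to make it orthogonal to `x`.
  have h3 := hcon (v - (inner ℝ x v / inner ℝ x w.fst) • w.fst) (by
    rw [inner_sub_right, inner_smul_right, div_mul_cancel₀ _ hw2, sub_self])
  rw [map_sub, map_smul, inner_sub_right, inner_smul_right, h1, mul_zero, sub_zero, hv,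
    inner_self_eq_zero] at h3
  exact hn h3

/-- If `x` is a critical point of the restriction of `ψ / ‖ψ‖` to its sphere, then the kernel of
the differential of the control function on the stratum at `(x, θ)`, where the direction `θ` is
orthogonal to `ψ x`, is horizontal. -/
theorem snd_eq_zero_of_mem_kerDiffRestrict (hdiff : ∀ x ∈ U, DifferentiableAt ℝ ψ x)
    {x : E m} (hxU : x ∈ U) (hψx : ψ x ≠ 0) {θ : ℝ}
    (hθ : quarterTurn (ψ x) = ‖ψ x‖ • unitVector θ)
    (hcrit : ∀ v, inner ℝ x v = 0 → inner ℝ (quarterTurn (ψ x)) (fderiv ℝ ψ x v) = 0)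
    {w : Total m}
    (hp : WithLp.toLp 2 (x, θ) ∈ stratumX ψ U)
    (hw : w ∈ kerDiffRestrict (control m) (stratumX ψ U) (WithLp.toLp 2 (x, θ))) :
    w.snd = 0 := by
  obtain ⟨D, hD, hDv⟩ := hasFDerivAt_seade (p := WithLp.toLp 2 (x, θ)) (hdiff x hxU)
  have h0 := eq_zero_of_mem_tangentSpaceAt hD (fun q hq => hq.2.1) hp hw.1
  have h1 : fderiv ℝ (control m) (WithLp.toLp 2 (x, θ)) w = 0 := hw.2
  rw [fderiv_control] at h1
  have h2 := hcrit w.fst (by simpa using h1)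
  have hpos : 0 < ‖ψ x‖ := norm_pos_iff.2 hψx
  rw [hθ, real_inner_smul_left] at h2
  have h3 : inner ℝ (unitVector θ) (fderiv ℝ ψ x w.fst) = 0 :=
    (mul_eq_zero.1 h2).resolve_left hpos.ne'
  have h4 : ‖ψ x‖ * inner ℝ (quarterTurn (unitVector θ)) (ψ x) = - ‖ψ x‖ ^ 2 := by
    rw [← real_inner_smul_left, ← map_smul, ← hθ, quarterTurn_quarterTurn, inner_neg_left,
      real_inner_self_eq_norm_sq]
  rw [hDv] at h0
  have h5 : w.snd * inner ℝ (quarterTurn (unitVector θ)) (ψ x) = 0 := by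
    have : inner ℝ (unitVector θ) (fderiv ℝ ψ x w.fst) +
      w.snd * inner ℝ (quarterTurn (unitVector θ)) (ψ x) = 0 := h0
    rwa [h3, zero_add] at this
  refine (mul_eq_zero.1 h5).resolve_right fun h => ?_
  rw [h, mul_zero] at h4
  nlinarith

/-- Sequential compactness of the Grassmannian of linear subspaces of a Euclidean space. -/
theorem exists_subseq_subspaceTendsto {V : Type*} [NormedAddCommGroup V] [InnerProductSpace ℝ V]
    [FiniteDimensional ℝ V] (K : ℕ → Submodule ℝ V) :
    ∃ (τ : Submodule ℝ V) (φ : ℕ → ℕ), StrictMono φ ∧ SubspaceTendsto (fun n => K (φ n)) τ := by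
  have : ProperSpace (V →L[ℝ] V) := FiniteDimensional.proper ℝ _
  obtain ⟨P, -, φ, hφ, hP⟩ := (isCompact_closedBall (0 : V →L[ℝ] V) 1).tendsto_subseq
    (x := fun n => (K n).starProjection) fun n => by
      rw [mem_closedBall_zero_iff]
      exact (K n).starProjection_norm_le
  have hstar : IsStarProjection P := by
    refine ⟨?_, ?_⟩
    · refine tendsto_nhds_unique (hP.mul hP) (hP.congr fun n => ?_)
      exact ((K (φ n)).isIdempotentElem_starProjection).symm
    · refine tendsto_nhds_unique hP.star (hP.congr fun n => ?_)
      exact (isSelfAdjoint_starProjection (K (φ n))).symm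
  obtain ⟨_, h⟩ := isStarProjection_iff_eq_starProjection_range.1 hstar
  refine ⟨P.range, φ, hφ, ?_⟩
  unfold SubspaceTendsto
  have h' : P = (LinearMap.range (P : V →ₗ[ℝ] V)).starProjection := h
  rw [← h']
  exact hP

/-- Near the origin, `ψ / ‖ψ‖` has no critical points on the spheres. Otherwise a sequence of
critical points `x_n → 0` would yield horizontal kernels at points `(x_n, θ_n)` of the stratum, hence a
horizontal limit, which cannot contain the tangent space of `{0} × ℝ`. -/
theorem exists_radius_orthogonal
    (hdiff : ∀ x ∈ U, DifferentiableAt ℝ ψ x)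
    (hc : IsBekkaRegular (stratumX ψ U) (stratumY m) (control m)) :
    ∃ r : ℝ, 0 < r ∧ ∀ x ∈ U, ‖x‖ ≤ r → x ≠ 0 → ψ x ≠ 0 →
      ∃ v, inner ℝ x v = 0 ∧ inner ℝ (quarterTurn (ψ x)) (fderiv ℝ ψ x v) ≠ 0 := by
  by_contra! hcon
  choose x hxU hxr hx0 hψx hbad using fun n : ℕ => hcon (1 / (n + 1)) Nat.one_div_pos_of_nat
  choose θ hθm hθ using fun n => exists_eq_norm_smul_unitVector (quarterTurn (ψ (x n)))
  simp only [norm_quarterTurn] at hθ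
  obtain ⟨θ', -, φ, hφ, hθ'⟩ := isCompact_Icc.tendsto_subseq hθm
  let p : ℕ → Total m := fun n => WithLp.toLp 2 (x n, θ n)
  obtain ⟨τ, χ, hχ, hτ⟩ := exists_subseq_subspaceTendsto fun n =>
    kerDiffRestrict (control m) (stratumX ψ U) (p (φ n))
  have hpX : ∀ n, p n ∈ stratumX ψ U := by
    intro n
    refine ⟨hxU n, ?_, hx0 n⟩
    have h1 : ‖ψ (x n)‖ * seade ψ (p n) = 0 := by
      change ‖ψ (x n)‖ * inner ℝ (unitVector (θ n)) (ψ (x n)) = 0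
      rw [← real_inner_smul_left, ← hθ, inner_plane]
      simp [mul_comm]
    exact (mul_eq_zero.1 h1).resolve_left (norm_ne_zero_iff.2 (hψx n))
  have hx : Tendsto x atTop (𝓝 0) :=
    squeeze_zero_norm hxr tendsto_one_div_add_atTop_nhds_zero_nat
  have hp : Tendsto (fun n => p (φ (χ n))) atTop (𝓝 (WithLp.toLp 2 ((0 : E m), θ'))) := by
    have h := (hx.comp (hφ.comp hχ).tendsto_atTop).prodMk_nhds (hθ'.comp hχ.tendsto_atTop)
    exact ((WithLp.prodContinuousLinearEquiv 2 ℝ (E m) ℝ).symm.continuous.tendsto _).comp h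
  have hle := hc.limit (fun n => p (φ (χ n))) _ τ (fun n => hpX _) rfl hp hτ
  have hmem := hle (mem_tangentSpaceAt_stratumY θ')
  set e : Total m := WithLp.toLp 2 ((0 : E m), (1 : ℝ)) with he
  let S : Total m →L[ℝ] ℝ := WithLp.sndL 2 ℝ (E m) ℝ
  have hlim : Tendsto (fun n => S ((kerDiffRestrict (control m) (stratumX ψ U)
      (p (φ (χ n)))).starProjection e)) atTop (𝓝 (S (τ.starProjection e))) := by
    have hev : Continuous fun A : Total m →L[ℝ] Total m => S (A e) := by fun_prop
    exact (hev.tendsto _).comp hτ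
  have hzero : ∀ n, S ((kerDiffRestrict (control m) (stratumX ψ U)
      (p (φ (χ n)))).starProjection e) = 0 := fun n =>
    snd_eq_zero_of_mem_kerDiffRestrict hdiff (hxU _) (hψx _) (hθ _) (hbad _)
      (hpX _) (Submodule.starProjection_apply_mem _ _)
  simp only [hzero] at hlim
  have h1 := tendsto_nhds_unique hlim tendsto_const_nhds
  rw [Submodule.starProjection_eq_self_iff.2 hmem] at h1
  exact one_ne_zero (α := ℝ) h1

end Transversality

/-! ### A tangential vector field turning `ψ / ‖ψ‖` at unit speed -/

section Field

variable {V : Type} [NormedAddCommGroup V] [InnerProductSpace ℝ V]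

/-- The operator `v ↦ ‖x‖² v - ⟪x, v⟫ x`, which is `‖x‖²` times the orthogonal projection onto the
hyperplane `xᗮ` and, unlike that projection, depends smoothly on `x` also at the origin. -/
def scaledProj (x : V) : V →L[ℝ] V :=
  ‖x‖ ^ 2 • ContinuousLinearMap.id ℝ V - (innerSL ℝ x).smulRight x

theorem scaledProj_apply (x v : V) : scaledProj x v = ‖x‖ ^ 2 • v - inner ℝ x v • x := rfl

theorem inner_scaledProj (x v : V) : inner ℝ x (scaledProj x v) = 0 := by
  rw [scaledProj_apply, inner_sub_right, inner_smul_right, inner_smul_right,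
    real_inner_self_eq_norm_sq]
  ring

theorem scaledProj_of_inner_eq_zero {x v : V} (h : inner ℝ x v = 0) :
    scaledProj x v = ‖x‖ ^ 2 • v := by
  rw [scaledProj_apply, h, zero_smul, sub_zero]

theorem contDiff_scaledProj : ContDiff ℝ ∞ (scaledProj : V → V →L[ℝ] V) := by
  refine ((contDiff_norm_sq ℝ).smul contDiff_const).sub ?_
  have h : ContDiff ℝ ∞ fun x : V => innerSL ℝ x := (innerSL ℝ).contDiff
  exact h.smulRight contDiff_id

variable {U : Set V} {ψ : V → E 2}

theorem surjective_fderiv_comp_scaledProj {x : V} (hx : x ≠ 0)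
    (h : ∀ n : E 2, n ≠ 0 → ∃ v, inner ℝ x v = 0 ∧ inner ℝ n (fderiv ℝ ψ x v) ≠ 0) :
    Function.Surjective (fderiv ℝ ψ x ∘L scaledProj x) := by
  rw [← ContinuousLinearMap.coe_coe, ← LinearMap.range_eq_top, ← Submodule.orthogonal_eq_bot_iff,
    Submodule.eq_bot_iff]
  intro n hn
  by_contra hn0
  obtain ⟨v, hxv, hv⟩ := h n hn0
  have h1 := (Submodule.mem_orthogonal' _ _).1 hn _ (LinearMap.mem_range_self _ v)
  rw [ContinuousLinearMap.coe_coe, ContinuousLinearMap.comp_apply,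
    scaledProj_of_inner_eq_zero hxv, map_smul, inner_smul_right] at h1
  exact hv ((mul_eq_zero.1 h1).resolve_left (by simpa using hx))

/-- Near a point where `ψ` does not vanish and `ψ / ‖ψ‖` is submersive on the sphere, a suitable
multiple of a tangential field turns `ψ / ‖ψ‖` at unit speed. -/
theorem exists_local_field_of_ne_zero (hU : IsOpen U) (hψ : ContDiffOn ℝ ∞ ψ U) {x₀ : V}
    (hx₀ : x₀ ∈ U) (hx : x₀ ≠ 0) (hne : ψ x₀ ≠ 0)
    (h : ∃ v, inner ℝ x₀ v = 0 ∧ inner ℝ (quarterTurn (ψ x₀)) (fderiv ℝ ψ x₀ v) ≠ 0) :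
    ∃ N ∈ 𝓝 x₀, ∃ g : V → V, ContDiffOn ℝ ∞ g N ∧ ∀ y ∈ N, inner ℝ y (g y) = 0 ∧
      inner ℝ (quarterTurn (ψ y)) (fderiv ℝ ψ y (g y)) = ‖ψ y‖ ^ 2 ∧ ψ y ≠ 0 := by
  obtain ⟨v, hxv, hv⟩ := h
  let f : V → ℝ := fun y => inner ℝ (quarterTurn (ψ y)) (fderiv ℝ ψ y (scaledProj y v))
  have hf : ContDiffOn ℝ ∞ f U := by
    have h1 : ContDiffOn ℝ ∞ (fderiv ℝ ψ) U := hψ.fderiv_of_isOpen hU (by simp)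
    have h2 : ContDiffOn ℝ ∞ (fun y => scaledProj y v) U :=
      (contDiff_scaledProj.clm_apply contDiff_const).contDiffOn
    exact (quarterTurn.contDiff.comp_contDiffOn hψ).inner ℝ (h1.clm_apply h2)
  have hf0 : f x₀ ≠ 0 := by
    change inner ℝ _ (fderiv ℝ ψ x₀ (scaledProj x₀ v)) ≠ 0
    rw [scaledProj_of_inner_eq_zero hxv, map_smul, inner_smul_right]
    exact mul_ne_zero (by simpa using hx) hv
  refine ⟨U ∩ {y | ψ y ≠ 0 ∧ f y ≠ 0}, ?_, fun y => (‖ψ y‖ ^ 2 / f y) • scaledProj y v, ?_, ?_⟩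
  · have hUn := hU.mem_nhds hx₀
    filter_upwards [hUn, (hψ.continuousOn.continuousAt hUn).eventually_ne hne,
      (hf.continuousOn.continuousAt hUn).eventually_ne hf0] with y h1 h2 h3
    exact ⟨h1, h2, h3⟩
  · have hψ' := hψ.mono (Set.inter_subset_left (t := {y | ψ y ≠ 0 ∧ f y ≠ 0}))
    exact ((hψ'.norm_sq ℝ).div (hf.mono Set.inter_subset_left) fun y hy => hy.2.2).smul
      (contDiff_scaledProj.clm_apply contDiff_const).contDiffOn
  · rintro y ⟨-, hy, hfy⟩
    refine ⟨by rw [inner_smul_right, inner_scaledProj, mul_zero], ?_, hy⟩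
    rw [map_smul, inner_smul_right]
    exact div_mul_cancel₀ _ hfy

/-- Near a zero of `ψ` at which the zero set is transverse to the sphere, there is a tangential
field lifting the rotation field of the plane. It vanishes on the zero set. -/
theorem exists_local_field_of_surjective (hU : IsOpen U) (hψ : ContDiffOn ℝ ∞ ψ U) {x₀ : V}
    (hx₀ : x₀ ∈ U) (h : Function.Surjective (fderiv ℝ ψ x₀ ∘L scaledProj x₀)) :
    ∃ N ∈ 𝓝 x₀, ∃ g : V → V, ContDiffOn ℝ ∞ g N ∧ ∀ y ∈ N, inner ℝ y (g y) = 0 ∧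
      inner ℝ (quarterTurn (ψ y)) (fderiv ℝ ψ y (g y)) = ‖ψ y‖ ^ 2 ∧ (ψ y = 0 → g y = 0) := by
  obtain ⟨R', hR'⟩ := LinearMap.exists_rightInverse_of_surjective
    (fderiv ℝ ψ x₀ ∘L scaledProj x₀ : V →ₗ[ℝ] E 2) (LinearMap.range_eq_top.2 h)
  let R : E 2 →L[ℝ] V := LinearMap.toContinuousLinearMap R'
  let L : V → E 2 →L[ℝ] E 2 := fun y => fderiv ℝ ψ y ∘L scaledProj y ∘L R
  have hL : ContDiffOn ℝ ∞ L U := by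
    have h1 : ContDiffOn ℝ ∞ (fderiv ℝ ψ) U := hψ.fderiv_of_isOpen hU (by simp)
    have h2 : ContDiffOn ℝ ∞ (fun y => scaledProj y ∘L R) U :=
      (contDiff_scaledProj.clm_comp contDiff_const).contDiffOn
    exact h1.clm_comp h2
  have hL0 : L x₀ = 1 := by
    ext1 w
    exact LinearMap.congr_fun hR' w
  have hopen : {A : E 2 →L[ℝ] E 2 | IsUnit A} ∈ 𝓝 (L x₀) :=
    Units.isOpen.mem_nhds (by rw [hL0]; exact isUnit_one)
  refine ⟨U ∩ {y | IsUnit (L y)}, ?_,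
    fun y => scaledProj y (R (Ring.inverse (L y) (quarterTurn (ψ y)))), ?_, ?_⟩
  · have hUn := hU.mem_nhds hx₀
    exact inter_mem hUn ((hL.continuousOn.continuousAt hUn) hopen)
  · have h1 : ContDiffOn ℝ ∞ (fun y => Ring.inverse (L y)) (U ∩ {y | IsUnit (L y)}) := by
      rintro y ⟨hy, hu⟩
      obtain ⟨u, hu⟩ := hu
      have h3 : ContDiffAt ℝ ∞ Ring.inverse (L y) := hu ▸ contDiffAt_ringInverse ℝ u
      exact h3.comp_contDiffWithinAt y ((hL y hy).mono Set.inter_subset_left)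
    have h2 : ContDiffOn ℝ ∞ (fun y => quarterTurn (ψ y)) (U ∩ {y | IsUnit (L y)}) :=
      quarterTurn.contDiff.comp_contDiffOn (hψ.mono Set.inter_subset_left)
    exact contDiff_scaledProj.contDiffOn.clm_apply (R.contDiff.comp_contDiffOn (h1.clm_apply h2))
  · rintro y ⟨-, hu⟩
    refine ⟨inner_scaledProj _ _, ?_, fun h0 => by simp [h0]⟩
    have h1 : L y (Ring.inverse (L y) (quarterTurn (ψ y))) = quarterTurn (ψ y) := by
      change (L y * Ring.inverse (L y)) _ = _
      rw [Ring.mul_inverse_cancel _ hu]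
      rfl
    change inner ℝ _ (L y _) = _
    rw [h1, real_inner_self_eq_norm_sq, norm_quarterTurn]

/-- The local fields are glued with a partition of unity; the conditions imposed are convex. The
result vanishes on the zero set of `ψ` in the sphere, so that the zero set is fixed by the flow. -/
theorem exists_field [FiniteDimensional ℝ V] (hU : IsOpen U) (hψ : ContDiffOn ℝ ∞ ψ U)
    {ε : ℝ} (hε : 0 < ε) (hεU : Metric.sphere (0 : V) ε ⊆ U)
    (hzero : ∀ x ∈ Metric.sphere (0 : V) ε, ψ x = 0 → ∀ n : E 2, n ≠ 0 →
      ∃ v, inner ℝ x v = 0 ∧ inner ℝ n (fderiv ℝ ψ x v) ≠ 0)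
    (hne : ∀ x ∈ Metric.sphere (0 : V) ε, ψ x ≠ 0 →
      ∃ v, inner ℝ x v = 0 ∧ inner ℝ (quarterTurn (ψ x)) (fderiv ℝ ψ x v) ≠ 0) :
    ∃ X : V → V, ContDiff ℝ ∞ X ∧ HasCompactSupport X ∧ (∀ x, inner ℝ x (X x) = 0) ∧
      (∀ x ∈ Metric.sphere (0 : V) ε,
        inner ℝ (quarterTurn (ψ x)) (fderiv ℝ ψ x (X x)) = ‖ψ x‖ ^ 2) ∧
      ∀ x ∈ Metric.sphere (0 : V) ε, ψ x = 0 → X x = 0 := by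
  let t : V → Set V := fun x => {v | inner ℝ x v = 0 ∧ (2 * ε ≤ ‖x‖ → v = 0) ∧
    (x ∈ Metric.sphere (0 : V) ε →
      inner ℝ (quarterTurn (ψ x)) (fderiv ℝ ψ x v) = ‖ψ x‖ ^ 2 ∧ (ψ x = 0 → v = 0))}
  have ht : ∀ x, Convex ℝ (t x) := by
    rintro x v ⟨hv1, hv2, hv3⟩ w ⟨hw1, hw2, hw3⟩ a b - - hab
    refine ⟨?_, fun h => ?_, fun h => ⟨?_, fun h0 => ?_⟩⟩
    · rw [inner_add_right, inner_smul_right, inner_smul_right, hv1, hw1]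
      simp
    · rw [hv2 h, hw2 h]
      simp
    · rw [map_add, map_smul, map_smul, inner_add_right, inner_smul_right, inner_smul_right,
        (hv3 h).1, (hw3 h).1, ← add_mul, hab, one_mul]
    · rw [(hv3 h).2 h0, (hw3 h).2 h0]
      simp
  have hloc : ∀ x₀ : V, ∃ N ∈ 𝓝 x₀, ∃ g : V → V, ContDiffOn ℝ ∞ g N ∧ ∀ y ∈ N, g y ∈ t y := by
    intro x₀
    by_cases hx₀ : x₀ ∈ Metric.sphere (0 : V) ε
    · have hx₀' : ‖x₀‖ = ε := by simpa using hx₀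
      have hnz : x₀ ≠ 0 := by
        rintro rfl
        exact hε.ne (by simpa using hx₀')
      have key : ∃ N ∈ 𝓝 x₀, ∃ g : V → V, ContDiffOn ℝ ∞ g N ∧ ∀ y ∈ N, inner ℝ y (g y) = 0 ∧
          inner ℝ (quarterTurn (ψ y)) (fderiv ℝ ψ y (g y)) = ‖ψ y‖ ^ 2 ∧ (ψ y = 0 → g y = 0) := by
        by_cases h0 : ψ x₀ = 0
        · exact exists_local_field_of_surjective hU hψ (hεU hx₀)
            (surjective_fderiv_comp_scaledProj hnz (hzero x₀ hx₀ h0))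
        · obtain ⟨N, hN, g, hg, h⟩ := exists_local_field_of_ne_zero hU hψ (hεU hx₀) hnz h0
            (hne x₀ hx₀ h0)
          exact ⟨N, hN, g, hg, fun y hy => ⟨(h y hy).1, (h y hy).2.1,
            fun h0 => absurd h0 (h y hy).2.2⟩⟩
      obtain ⟨N, hN, g, hg, h⟩ := key
      have hball : {y : V | ‖y‖ < 2 * ε} ∈ 𝓝 x₀ :=
        (continuous_norm.continuousAt.eventually_lt_const (by linarith : ‖x₀‖ < 2 * ε))
      refine ⟨N ∩ {y | ‖y‖ < 2 * ε}, inter_mem hN hball, g, hg.mono Set.inter_subset_left, ?_⟩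
      rintro y ⟨hy, hy2⟩
      exact ⟨(h y hy).1, fun h2 => absurd h2 (not_le.2 hy2), fun _ => (h y hy).2⟩
    · refine ⟨(Metric.sphere (0 : V) ε)ᶜ, Metric.isClosed_sphere.isOpen_compl.mem_nhds hx₀,
        fun _ => 0, contDiffOn_const, fun y hy => ⟨inner_zero_right _, fun _ => rfl,
        fun h => absurd h hy⟩⟩
  obtain ⟨X, hX⟩ := exists_contMDiffMap_forall_mem_convex_of_local (n := ⊤)
    (modelWithCornersSelf ℝ V) ht fun x => by
      obtain ⟨N, hN, g, hg, h⟩ := hloc x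
      exact ⟨N, hN, g, contMDiffOn_iff_contDiffOn.2 hg, h⟩
  refine ⟨X, contMDiff_iff_contDiff.1 X.contMDiff, ?_, fun x => (hX x).1,
    fun x hx => ((hX x).2.2 hx).1, fun x hx => ((hX x).2.2 hx).2⟩
  refine HasCompactSupport.intro (isCompact_closedBall (0 : V) (2 * ε)) fun x hx => ?_
  refine (hX x).2.1 ?_
  rw [mem_closedBall_zero_iff, not_le] at hx
  exact hx.le

end Field

/-! ### Invariance properties of the flow -/

section Invariance

variable {V : Type} [NormedAddCommGroup V] [InnerProductSpace ℝ V] {X : V → V} {K : NNReal}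
  {δ : ℝ} {Φ : ℝ × V → V}

theorem norm_flow_eq (h0 : ∀ x, Φ (0, x) = x)
    (hd : ∀ x, ∀ t ∈ Set.Ioo (-δ) δ, HasDerivAt (fun s => Φ (s, x)) (X (Φ (t, x))) t)
    (hX : ∀ x, inner ℝ x (X x) = 0) (x : V) {t : ℝ} (ht : t ∈ Set.Ioo (-δ) δ) :
    ‖Φ (t, x)‖ = ‖x‖ := by
  have hder : ∀ s ∈ Set.Ioo (-δ) δ, HasDerivAt (fun s => ‖Φ (s, x)‖ ^ 2) 0 s := fun s hs => by
    have h := (hd x s hs).norm_sq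
    rwa [hX, mul_zero] at h
  have hδ : (0 : ℝ) ∈ Set.Ioo (-δ) δ := ⟨by linarith [ht.1, ht.2], by linarith [ht.1, ht.2]⟩
  obtain ⟨c, hc⟩ := isOpen_Ioo.exists_is_const_of_deriv_eq_zero isPreconnected_Ioo
    (fun s hs => (hder s hs).differentiableAt.differentiableWithinAt)
    (fun s hs => (hder s hs).deriv)
  have h1 := (hc t ht).trans (hc 0 hδ).symm
  simp only [h0] at h1
  exact (sq_eq_sq₀ (norm_nonneg _) (norm_nonneg _)).1 h1

theorem flow_eq_self_of_eq_zero (hK : LipschitzWith K X) (h0 : ∀ x, Φ (0, x) = x)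
    (hd : ∀ x, ∀ t ∈ Set.Ioo (-δ) δ, HasDerivAt (fun s => Φ (s, x)) (X (Φ (t, x))) t)
    {x : V} (hx : X x = 0) {t : ℝ} (ht : t ∈ Set.Ioo (-δ) δ) : Φ (t, x) = x := by
  have hδ : (0 : ℝ) ∈ Set.Ioo (-δ) δ := ⟨by linarith [ht.1, ht.2], by linarith [ht.1, ht.2]⟩
  refine ODE_solution_unique_of_mem_Ioo (v := fun _ => X) (s := fun _ => Set.univ) (K := K)
    (f := fun s => Φ (s, x)) (g := fun _ => x) (fun _ _ => hK.lipschitzOnWith) hδ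
    (fun s hs => ⟨hd x s hs, trivial⟩) (fun s _ => ⟨?_, trivial⟩) (h0 x) ht
  rw [hx]
  exact hasDerivAt_const s x

theorem flow_neg_flow (hK : LipschitzWith K X) (h0 : ∀ x, Φ (0, x) = x)
    (hd : ∀ x, ∀ t ∈ Set.Ioo (-δ) δ, HasDerivAt (fun s => Φ (s, x)) (X (Φ (t, x))) t)
    (x : V) {t : ℝ} (ht : t ∈ Set.Ioo (-δ) δ) : Φ (-t, Φ (t, x)) = x := by
  obtain ⟨ht1, ht2⟩ := ht
  have hδ : 0 < δ := by linarith
  have key := ODE_solution_unique_of_mem_Ioo (v := fun _ => X) (s := fun _ => Set.univ) (K := K)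
    (f := fun s => Φ (s, Φ (t, x))) (g := fun s => Φ (s + t, x)) (t₀ := 0)
    (a := max (-δ) (-δ - t)) (b := min δ (δ - t))
    (fun _ _ => hK.lipschitzOnWith) ⟨max_lt (by linarith) (by linarith),
      lt_min (by linarith) (by linarith)⟩
    (fun s hs => ⟨hd _ s ⟨(le_max_left _ _).trans_lt hs.1, hs.2.trans_le (min_le_left _ _)⟩,
      trivial⟩)
    (fun s hs => ⟨(hd x (s + t) ⟨by linarith [(le_max_right _ _).trans_lt hs.1],
      by linarith [hs.2.trans_le (min_le_right _ _)]⟩).comp_add_const s t, trivial⟩)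
    (by simp [h0])
  have h := @key (-t) ⟨max_lt (by linarith) (by linarith), lt_min (by linarith) (by linarith)⟩
  simpa [h0] using h

end Invariance

/-! ### Rotations of the plane -/

/-- Rotation of the plane by the angle `t`. -/
def rotation (t : ℝ) (w : E 2) : E 2 := Real.cos t • w + Real.sin t • quarterTurn w

theorem rotation_zero (w : E 2) : rotation 0 w = w := by simp [rotation]

theorem rotation_rotation (s t : ℝ) (w : E 2) : rotation s (rotation t w) = rotation (s + t) w := by
  ext i
  fin_cases i <;> simp [rotation, Real.cos_add, Real.sin_add] <;> ring

theorem rotation_unitVector (s t : ℝ) : rotation s (unitVector t) = unitVector (s + t) := by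
  ext i
  fin_cases i <;> simp [rotation, unitVector, Real.cos_add, Real.sin_add] <;> ring

theorem hasDerivAt_rotation (t : ℝ) (w : E 2) :
    HasDerivAt (fun s => rotation s w) (quarterTurn (rotation t w)) t := by
  have h : quarterTurn (rotation t w) = -Real.sin t • w + Real.cos t • quarterTurn w := by
    simp only [rotation, map_add, map_smul, quarterTurn_quarterTurn]
    module
  rw [h]
  exact ((Real.hasDerivAt_cos t).smul_const _).add ((Real.hasDerivAt_sin t).smul_const _)

theorem inner_smul_add_inner_quarterTurn_smul (u w : E 2) :
    inner ℝ u w • u + inner ℝ (quarterTurn u) w • quarterTurn u = ‖u‖ ^ 2 • w := by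
  rw [norm_sq_plane, inner_plane, inner_plane]
  ext i
  fin_cases i <;> simp <;> ring

theorem norm_normalize {w : E 2} (hw : w ≠ 0) : ‖‖w‖⁻¹ • w‖ = 1 := by
  rw [norm_smul, norm_inv, norm_norm, inv_mul_cancel₀ (norm_ne_zero_iff.2 hw)]

/-- If the angular velocity of a plane curve is one, then its direction rotates at unit speed. -/
theorem hasDerivAt_normalize {p : ℝ → E 2} {p' : E 2} {t : ℝ} (hp : HasDerivAt p p' t)
    (hne : p t ≠ 0) (h : inner ℝ (quarterTurn (p t)) p' = ‖p t‖ ^ 2) :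
    HasDerivAt (fun s => ‖p s‖⁻¹ • p s) (quarterTurn (‖p t‖⁻¹ • p t)) t := by
  have hpos : 0 < ‖p t‖ := norm_pos_iff.2 hne
  have hnorm : HasDerivAt (fun s => ‖p s‖) (inner ℝ (p t) p' / ‖p t‖) t := by
    have h1 := hp.norm_sq.sqrt (by positivity)
    simp only [Real.sqrt_sq (norm_nonneg _)] at h1
    refine h1.congr_deriv ?_
    field_simp
  have h2 := (hnorm.inv hpos.ne').smul hp
  refine h2.congr_deriv ?_
  have h3 := inner_smul_add_inner_quarterTurn_smul (p t) p'
  rw [h] at h3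
  set c : ℝ := inner ℝ (p t) p'
  have h4 : p' = (c / ‖p t‖ ^ 2) • p t + quarterTurn (p t) := by
    refine smul_right_injective (E 2) (pow_ne_zero 2 hpos.ne') ?_
    simp only [smul_add, smul_smul, mul_div_cancel₀ c (pow_ne_zero 2 hpos.ne')]
    exact h3.symm
  change ‖p t‖⁻¹ • p' + (-(c / ‖p t‖) / ‖p t‖ ^ 2) • p t = _
  rw [map_smul, h4]
  match_scalars
  · field_simp
    ring
  · simp

theorem normalize_eq_rotation {p : ℝ → E 2} {p' : ℝ → E 2} {δ : ℝ}
    (hp : ∀ t ∈ Set.Ioo (-δ) δ, HasDerivAt p (p' t) t) (hne : ∀ t ∈ Set.Ioo (-δ) δ, p t ≠ 0)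
    (h : ∀ t ∈ Set.Ioo (-δ) δ, inner ℝ (quarterTurn (p t)) (p' t) = ‖p t‖ ^ 2)
    {t : ℝ} (ht : t ∈ Set.Ioo (-δ) δ) :
    ‖p t‖⁻¹ • p t = rotation t (‖p 0‖⁻¹ • p 0) := by
  have hδ : (0 : ℝ) ∈ Set.Ioo (-δ) δ := ⟨by linarith [ht.1, ht.2], by linarith [ht.1, ht.2]⟩
  exact ODE_solution_unique_of_mem_Ioo (v := fun _ => quarterTurn) (s := fun _ => Set.univ)
    (f := fun s => ‖p s‖⁻¹ • p s) (g := fun s => rotation s (‖p 0‖⁻¹ • p 0))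
    (fun _ _ => quarterTurn.lipschitz.lipschitzOnWith) hδ
    (fun s hs => ⟨hasDerivAt_normalize (hp s hs) (hne s hs) (h s hs), trivial⟩)
    (fun s _ => ⟨hasDerivAt_rotation s _, trivial⟩) (rotation_zero _).symm ht

/-- The angle from `b` to `w`, for unit vectors `w` in the open half plane around `b`. -/
def angleFrom (b w : E 2) : ℝ := Real.arcsin (inner ℝ (quarterTurn b) w)

theorem rotation_angleFrom {b w : E 2} (hb : ‖b‖ = 1) (hw : ‖w‖ = 1) (hbw : 0 < inner ℝ b w) :
    rotation (angleFrom b w) b = w := by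
  have h1 : inner ℝ b w ^ 2 + inner ℝ (quarterTurn b) w ^ 2 = 1 := by
    have hb' := norm_sq_plane b
    have hw' := norm_sq_plane w
    rw [hb] at hb'
    rw [hw] at hw'
    rw [inner_plane, inner_plane]
    simp only [quarterTurn_zero, quarterTurn_one]
    linear_combination (-1) * hb' - (b 0 ^ 2 + b 1 ^ 2) * hw'
  have habs : |inner ℝ (quarterTurn b) w| ≤ 1 := by
    rw [← sq_le_one_iff_abs_le_one]
    nlinarith
  have hcos : Real.cos (angleFrom b w) = inner ℝ b w := by
    rw [angleFrom, Real.cos_arcsin, ← h1, add_sub_cancel_right, Real.sqrt_sq hbw.le]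
  rw [rotation, hcos, angleFrom, Real.sin_arcsin (abs_le.1 habs).1 (abs_le.1 habs).2,
    inner_smul_add_inner_quarterTurn_smul, hb, one_pow, one_smul]

/-- The open sector around a unit vector `b` which meets the unit circle in the directions making an
angle less than `δ` with `b`, for small `δ`. -/
def sector (b : E 2) (δ : ℝ) : Set (E 2) :=
  {w | 0 < inner ℝ b w ∧ |inner ℝ (quarterTurn b) w| < Real.sin δ}

theorem isOpen_sector (b : E 2) (δ : ℝ) : IsOpen (sector b δ) := by
  have h1 : Continuous fun w : E 2 => inner ℝ b w := continuous_const.inner continuous_id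
  have h2 : Continuous fun w : E 2 => inner ℝ (quarterTurn b) w :=
    continuous_const.inner continuous_id
  exact (isOpen_lt continuous_const h1).inter (isOpen_lt h2.abs continuous_const)

theorem abs_angleFrom_lt {b w : E 2} {δ : ℝ} (hδ : 0 < δ) (hδ' : δ ≤ 1) (hw : w ∈ sector b δ) :
    |angleFrom b w| < δ := by
  have hpi : δ < Real.pi / 2 := by linarith [Real.pi_gt_three]
  obtain ⟨h1, h2⟩ := abs_lt.1 hw.2
  rw [← Real.sin_neg] at h1
  refine abs_lt.2 ⟨?_, ?_⟩
  · exact (Real.lt_arcsin_iff_sin_lt' ⟨by linarith, by linarith⟩).2 h1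
  · exact (Real.arcsin_lt_iff_lt_sin' ⟨by linarith, by linarith⟩).2 h2

theorem contDiffOn_angleFrom (b : E 2) (δ : ℝ) : ContDiffOn ℝ ∞ (angleFrom b) (sector b δ) := by
  intro w hw
  have h1 := abs_lt.1 (hw.2.trans_le (Real.sin_le_one δ))
  have h2 : ContDiff ℝ ∞ fun w : E 2 => inner ℝ (quarterTurn b) w :=
    contDiff_const.inner ℝ contDiff_id
  exact ((Real.contDiffAt_arcsin h1.1.ne' h1.2.ne).comp w h2.contDiffAt).contDiffWithinAt

/-! ### The fibration -/

section Fibration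

variable {V : Type} [NormedAddCommGroup V] [NormedSpace ℝ V] {ψ : V → E 2} {U A : Set V}
  {δ : ℝ} {Φ : ℝ × V → V}

omit [NormedAddCommGroup V] [NormedSpace ℝ V] in
/-- If a local flow on `A` moves the values of `ψ / ‖ψ‖` by rotation, these values fill the circle:
every angle is a finite sum of small ones. -/
theorem image_normalize_eq_sphere (hA : A.Nonempty) (hψA : ∀ x ∈ A, ψ x ≠ 0) (hδ : 0 < δ)
    (hΦA : ∀ x ∈ A, ∀ t ∈ Set.Ioo (-δ) δ, Φ (t, x) ∈ A)
    (hrot : ∀ x ∈ A, ∀ t ∈ Set.Ioo (-δ) δ,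
      ‖ψ (Φ (t, x))‖⁻¹ • ψ (Φ (t, x)) = rotation t (‖ψ x‖⁻¹ • ψ x)) :
    (fun x => ‖ψ x‖⁻¹ • ψ x) '' A = Metric.sphere (0 : E 2) 1 := by
  have hunit : ∀ x ∈ A, ‖‖ψ x‖⁻¹ • ψ x‖ = 1 := fun x hx => norm_normalize (hψA x hx)
  refine Set.Subset.antisymm ?_ ?_
  · rintro _ ⟨x, hx, rfl⟩
    exact mem_sphere_zero_iff_norm.2 (hunit x hx)
  · intro w hw
    rw [mem_sphere_zero_iff_norm] at hw
    obtain ⟨x, hx⟩ := hA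
    obtain ⟨α, -, hα⟩ := exists_eq_norm_smul_unitVector w
    obtain ⟨β, -, hβ⟩ := exists_eq_norm_smul_unitVector (‖ψ x‖⁻¹ • ψ x)
    rw [hw, one_smul] at hα
    rw [hunit x hx, one_smul] at hβ
    have hstep : ∀ s ∈ Set.Ioo (-δ) δ, ∀ k : ℕ,
        ∃ y ∈ A, ‖ψ y‖⁻¹ • ψ y = unitVector (k * s + β) := by
      intro s hs k
      induction k with
      | zero => exact ⟨x, hx, by rw [hβ]; simp⟩
      | succ k ih =>
        obtain ⟨y, hy, h⟩ := ih
        refine ⟨Φ (s, y), hΦA y hy s hs, ?_⟩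
        rw [hrot y hy s hs, h, rotation_unitVector]
        congr 1
        push_cast
        ring
    obtain ⟨k, hk⟩ := exists_nat_gt (|α - β| / δ)
    have hk0 : (0 : ℝ) < k := lt_of_le_of_lt (by positivity) hk
    obtain ⟨y, hy, h⟩ := hstep ((α - β) / k) (abs_lt.1 (by
      rw [abs_div, Nat.abs_cast, div_lt_iff₀ hk0, mul_comm]
      exact (div_lt_iff₀ hδ).1 hk)) k
    refine ⟨y, hy, h.trans ?_⟩
    rw [hα, mul_div_cancel₀ _ hk0.ne', sub_add_cancel]

/-- A local flow covering the rotations of the circle trivialises `ψ / ‖ψ‖` over sectors. -/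
theorem isSmoothFibreBundle_normalize (hU : IsOpen U) (hψ : ContDiffOn ℝ ∞ ψ U) (hAU : A ⊆ U)
    (hA : A.Nonempty) (hψA : ∀ x ∈ A, ψ x ≠ 0) (hδ : 0 < δ)
    (hΦ : ContDiffOn ℝ ∞ Φ (Set.Ioo (-δ) δ ×ˢ Set.univ))
    (hinv : ∀ x, ∀ t ∈ Set.Ioo (-δ) δ, Φ (-t, Φ (t, x)) = x)
    (hΦA : ∀ x ∈ A, ∀ t ∈ Set.Ioo (-δ) δ, Φ (t, x) ∈ A)
    (hrot : ∀ x ∈ A, ∀ t ∈ Set.Ioo (-δ) δ,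
      ‖ψ (Φ (t, x))‖⁻¹ • ψ (Φ (t, x)) = rotation t (‖ψ x‖⁻¹ • ψ x)) :
    IsSmoothFibreBundle (fun x => ‖ψ x‖⁻¹ • ψ x) A (Metric.sphere (0 : E 2) 1) := by
  set π : V → E 2 := fun x => ‖ψ x‖⁻¹ • ψ x
  have hO : IsOpen (U ∩ ψ ⁻¹' {0}ᶜ) :=
    hψ.continuousOn.isOpen_inter_preimage hU isClosed_singleton.isOpen_compl
  have hAO : A ⊆ U ∩ ψ ⁻¹' {0}ᶜ := fun x hx => ⟨hAU hx, hψA x hx⟩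
  have hπs : ContDiffOn ℝ ∞ π (U ∩ ψ ⁻¹' {0}ᶜ) := by
    have h1 := hψ.mono (Set.inter_subset_left (t := ψ ⁻¹' {0}ᶜ))
    exact ((h1.norm ℝ fun x hx => hx.2).inv fun x hx => norm_ne_zero_iff.2 hx.2).smul h1
  have hunit : ∀ x ∈ A, ‖π x‖ = 1 := fun x hx => norm_normalize (hψA x hx)
  refine ⟨fun a ha => ⟨_, hO, hAO ha, π, hπs, fun _ _ => rfl⟩,
    image_normalize_eq_sphere hA hψA hδ hΦA hrot, fun b hb => ?_⟩
  rw [mem_sphere_zero_iff_norm] at hb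
  let d := min δ 1
  have hd : 0 < d := lt_min hδ one_pos
  have hbd : b ∈ sector b d := by
    refine ⟨by rw [real_inner_self_eq_norm_sq, hb]; norm_num, ?_⟩
    have h0 : inner ℝ (quarterTurn b) b = 0 := by rw [inner_plane]; simp; ring
    rw [h0, abs_zero]
    exact Real.sin_pos_of_pos_of_lt_pi hd
      (by linarith [min_le_right δ 1, Real.pi_gt_three])
  have hang : ∀ w ∈ sector b d, angleFrom b w ∈ Set.Ioo (-δ) δ := fun w hw =>
    abs_lt.1 ((abs_angleFrom_lt hd (min_le_right _ _) hw).trans_le (min_le_left _ _))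
  have hang' : ∀ w ∈ sector b d, -angleFrom b w ∈ Set.Ioo (-δ) δ := fun w hw =>
    ⟨by linarith [(hang w hw).2], by linarith [(hang w hw).1]⟩
  have hrotb : ∀ w, ‖w‖ = 1 → w ∈ sector b d → rotation (angleFrom b w) b = w :=
    fun w hw hws => rotation_angleFrom hb hw hws.1
  have hproj : ∀ w ∈ Metric.sphere (0 : E 2) 1 ∩ sector b d, ∀ x ∈ A ∩ π ⁻¹' {b},
      π (Φ (angleFrom b w, x)) = w := by
    rintro w ⟨hw, hws⟩ x ⟨hx, hxb⟩
    rw [mem_sphere_zero_iff_norm] at hw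
    exact (hrot x hx _ (hang w hws)).trans (by
      rw [show ‖ψ x‖⁻¹ • ψ x = b from hxb, hrotb w hw hws])
  refine ⟨sector b d, isOpen_sector b d, hbd, fun q => Φ (angleFrom b q.1, q.2),
    ⟨?_, ?_, fun y => (π y, Φ (-angleFrom b (π y), y)), ?_, ?_, ?_, ?_⟩, hproj⟩
  · rintro q ⟨⟨-, hq⟩, -⟩
    refine ⟨sector b d ×ˢ Set.univ, (isOpen_sector b d).prod isOpen_univ, ⟨hq, trivial⟩, _, ?_,
      fun _ _ => rfl⟩
    refine hΦ.comp (((contDiffOn_angleFrom b d).comp contDiffOn_fst fun q hq => hq.1).prodMk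
      contDiffOn_snd) fun q hq => ⟨hang _ hq.1, trivial⟩
  · rintro ⟨w, x⟩ ⟨hw, hx⟩
    refine ⟨hΦA x hx.1 _ (hang w hw.2), ?_⟩
    rw [Set.mem_preimage, hproj w hw x hx]
    exact hw.2
  · rintro y ⟨hy, hys⟩
    refine ⟨(U ∩ ψ ⁻¹' {0}ᶜ) ∩ π ⁻¹' sector b d,
      hπs.continuousOn.isOpen_inter_preimage hO (isOpen_sector b d), ⟨hAO hy, hys⟩, _, ?_,
      fun _ _ => rfl⟩
    have h1 := hπs.mono (Set.inter_subset_left (t := π ⁻¹' sector b d))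
    have h2 : ContDiffOn ℝ ∞ (fun y => angleFrom b (π y)) _ :=
      (contDiffOn_angleFrom b d).comp h1 fun y hy => hy.2
    exact h1.prodMk (hΦ.comp (h2.neg.prodMk contDiffOn_id) fun y hy => ⟨hang' _ hy.2, trivial⟩)
  · rintro y ⟨hy, hys⟩
    refine ⟨⟨mem_sphere_zero_iff_norm.2 (hunit y hy), hys⟩, hΦA y hy _ (hang' _ hys), ?_⟩
    change π (Φ (-angleFrom b (π y), y)) = b
    refine (hrot y hy _ (hang' _ hys)).trans ?_
    change rotation _ (π y) = b
    have h := rotation_rotation (-angleFrom b (π y)) (angleFrom b (π y)) b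
    rwa [hrotb (π y) (hunit y hy) hys, neg_add_cancel, rotation_zero] at h
  · rintro ⟨w, x⟩ ⟨hw, hx⟩
    simp only [hproj w hw x hx, hinv x _ (hang w hw.2)]
  · rintro y ⟨hy, hys⟩
    have h := hinv y _ (hang' _ hys)
    rwa [neg_neg] at h

end Fibration

/-! ### The strong Milnor condition -/

section Sphere

variable {V : Type} [NormedAddCommGroup V] [InnerProductSpace ℝ V] {U : Set V} {ψ : V → E 2}

/-- If the zero set of `ψ` is transverse to a sphere, then it does not contain the sphere:
otherwise the derivative of `ψ` would vanish along great circles. -/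
theorem nonempty_sphere_diff [Nontrivial V] {ε : ℝ} (hε : 0 < ε)
    (hdiff : ∀ x ∈ Metric.sphere (0 : V) ε, DifferentiableAt ℝ ψ x)
    (hzero : ∀ x ∈ Metric.sphere (0 : V) ε, ψ x = 0 → ∀ n : E 2, n ≠ 0 →
      ∃ v, inner ℝ x v = 0 ∧ inner ℝ n (fderiv ℝ ψ x v) ≠ 0) :
    (Metric.sphere (0 : V) ε \ (ψ ⁻¹' {0} ∩ Metric.sphere (0 : V) ε)).Nonempty := by
  by_contra hemp
  have hall : ∀ x ∈ Metric.sphere (0 : V) ε, ψ x = 0 := by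
    intro x hx
    by_contra h
    exact hemp ⟨x, hx, fun h' => h h'.1⟩
  obtain ⟨x, hx⟩ := NormedSpace.sphere_nonempty (E := V) (x := 0) |>.2 hε.le
  obtain ⟨v, hxv, hv⟩ := hzero x hx (hall x hx) (unitVector 0) fun h => by
    simpa [unitVector] using congrArg (fun w : E 2 => w 0) h
  have hv0 : 0 < ‖v‖ := norm_pos_iff.2 fun h => hv (by rw [h, map_zero, inner_zero_right])
  rw [mem_sphere_zero_iff_norm] at hx
  -- The great circle through `x` in the direction of `v`.
  let γ : ℝ → V := fun t => Real.cos t • x + Real.sin t • ((ε / ‖v‖) • v)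
  have hγ : ∀ t, γ t ∈ Metric.sphere (0 : V) ε := by
    intro t
    rw [mem_sphere_zero_iff_norm, ← sq_eq_sq₀ (norm_nonneg _) hε.le]
    have hn : ‖(ε / ‖v‖) • v‖ = ε := by
      rw [norm_smul, Real.norm_of_nonneg (by positivity), div_mul_cancel₀ _ hv0.ne']
    rw [norm_add_sq_real, norm_smul, norm_smul, hn, hx, inner_smul_left, inner_smul_right,
      inner_smul_right, hxv, mul_pow, mul_pow, Real.norm_eq_abs, Real.norm_eq_abs, sq_abs, sq_abs]
    linear_combination ε ^ 2 * Real.sin_sq_add_cos_sq t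
  have hγ0 : γ 0 = x := by simp [γ]
  have hγ' : HasDerivAt γ ((ε / ‖v‖) • v) 0 := by
    have h := ((Real.hasDerivAt_cos 0).smul_const x).add
      ((Real.hasDerivAt_sin 0).smul_const ((ε / ‖v‖) • v))
    exact h.congr_deriv (by simp)
  have hd : HasFDerivAt ψ (fderiv ℝ ψ x) (γ 0) := by
    rw [hγ0]
    exact (hdiff x (mem_sphere_zero_iff_norm.2 hx)).hasFDerivAt
  have h1 := hd.comp_hasDerivAt 0 hγ'
  have h2 : ψ ∘ γ = fun _ => 0 := funext fun t => hall _ (hγ t)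
  rw [h2] at h1
  have h3 := h1.unique (hasDerivAt_const (0 : ℝ) (0 : E 2))
  rw [map_smul] at h3
  have h4 := (smul_eq_zero.1 h3).resolve_left (by positivity)
  rw [h4, inner_zero_right] at hv
  exact hv rfl

/-- A sphere to which the zero set of `ψ` is transverse, and on which `ψ / ‖ψ‖` has no critical
points, is fibred over the circle by `ψ / ‖ψ‖` outside the zero set. -/
theorem isSmoothFibreBundle_sphere [FiniteDimensional ℝ V] [Nontrivial V] (hU : IsOpen U)
    (hψ : ContDiffOn ℝ ∞ ψ U) {ε : ℝ} (hε : 0 < ε) (hεU : Metric.sphere (0 : V) ε ⊆ U)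
    (hzero : ∀ x ∈ Metric.sphere (0 : V) ε, ψ x = 0 → ∀ n : E 2, n ≠ 0 →
      ∃ v, inner ℝ x v = 0 ∧ inner ℝ n (fderiv ℝ ψ x v) ≠ 0)
    (hne : ∀ x ∈ Metric.sphere (0 : V) ε, ψ x ≠ 0 →
      ∃ v, inner ℝ x v = 0 ∧ inner ℝ (quarterTurn (ψ x)) (fderiv ℝ ψ x v) ≠ 0) :
    IsSmoothFibreBundle (fun x => ‖ψ x‖⁻¹ • ψ x)
      (Metric.sphere (0 : V) ε \ (ψ ⁻¹' {0} ∩ Metric.sphere (0 : V) ε))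
      (Metric.sphere (0 : E 2) 1) := by
  have hdiff : ∀ x ∈ U, DifferentiableAt ℝ ψ x := fun x hx =>
    (hψ.contDiffAt (hU.mem_nhds hx)).differentiableAt (by simp)
  obtain ⟨X, hXs, hXc, hXt, hX1, hX0⟩ := exists_field hU hψ hε hεU hzero hne
  obtain ⟨K, hK⟩ := hXs.lipschitzWith_of_hasCompactSupport hXc (by simp)
  obtain ⟨δ, hδ, Φ, hΦ, hΦ0, hΦd⟩ := exists_smooth_flow hXs hK
  have hinv : ∀ x, ∀ t ∈ Set.Ioo (-δ) δ, Φ (-t, Φ (t, x)) = x := fun x t ht =>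
    flow_neg_flow hK hΦ0 hΦd x ht
  have hΦS : ∀ x ∈ Metric.sphere (0 : V) ε, ∀ t ∈ Set.Ioo (-δ) δ,
      Φ (t, x) ∈ Metric.sphere (0 : V) ε := by
    intro x hx t ht
    rw [mem_sphere_zero_iff_norm] at hx ⊢
    rw [norm_flow_eq hΦ0 hΦd hXt x ht, hx]
  -- The zeros of `ψ` on the sphere are fixed, so the flow cannot reach them from outside.
  have hΦne : ∀ x ∈ Metric.sphere (0 : V) ε, ψ x ≠ 0 → ∀ t ∈ Set.Ioo (-δ) δ,
      ψ (Φ (t, x)) ≠ 0 := by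
    intro x hx hψx t ht h
    have h1 := flow_eq_self_of_eq_zero hK hΦ0 hΦd (hX0 _ (hΦS x hx t ht) h)
      (t := -t) ⟨by linarith [ht.2], by linarith [ht.1]⟩
    rw [hinv x t ht] at h1
    exact hψx (h1 ▸ h)
  have hmem : ∀ x, x ∈ Metric.sphere (0 : V) ε \ (ψ ⁻¹' {0} ∩ Metric.sphere (0 : V) ε) ↔
      x ∈ Metric.sphere (0 : V) ε ∧ ψ x ≠ 0 := fun x =>
    ⟨fun h => ⟨h.1, fun h' => h.2 ⟨h', h.1⟩⟩, fun h => ⟨h.1, fun h' => h.2 h'.1⟩⟩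
  refine isSmoothFibreBundle_normalize hU hψ (Set.sdiff_subset.trans hεU)
    (nonempty_sphere_diff hε (fun x hx => hdiff x (hεU hx)) hzero)
    (fun x hx => ((hmem x).1 hx).2) hδ hΦ hinv
    (fun x hx t ht => (hmem _).2 ⟨hΦS x hx.1 t ht, hΦne x hx.1 ((hmem x).1 hx).2 t ht⟩) ?_
  intro x hx t ht
  have hder : ∀ s ∈ Set.Ioo (-δ) δ, HasDerivAt (fun s => ψ (Φ (s, x)))
      (fderiv ℝ ψ (Φ (s, x)) (X (Φ (s, x)))) s := fun s hs =>
    (hdiff _ (hεU (hΦS x hx.1 s hs))).hasFDerivAt.comp_hasDerivAt s (hΦd x s hs)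
  have h := normalize_eq_rotation hder (fun s hs => hΦne x hx.1 ((hmem x).1 hx).2 s hs)
    (fun s hs => hX1 _ (hΦS x hx.1 s hs)) ht
  simpa only [hΦ0] using h

end Sphere

end Milnor

end

theorem corollary5p1 (m : ℕ) (hm : 2 ≤ m) (U : Set (Milnor.E m)) (hU : IsOpen U) (h0 : 0 ∈ U)
    (ψ : Milnor.E m → Milnor.E 2) (hψ : AnalyticOnNhd ℝ ψ U) (hψ0 : ψ 0 = 0)
    -- `ψ` has no critical point in `U` other than possibly the origin
    (hcrit : ∀ x ∈ U, x ≠ 0 → Function.Surjective (fderiv ℝ ψ x))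
    (hc : Milnor.IsBekkaRegular (Milnor.stratumX ψ U) (Milnor.stratumY m) (Milnor.control m)) :
    Milnor.StrongMilnorCondition ψ := by
  have hdiff : ∀ x ∈ U, DifferentiableAt ℝ ψ x := fun x hx => (hψ x hx).differentiableAt
  have hsm : ContDiffOn ℝ ∞ ψ U := hψ.contDiffOn hU.uniqueDiffOn
  have : Nonempty (Fin m) := ⟨⟨0, by omega⟩⟩
  obtain ⟨r, hr, hcritr⟩ := Milnor.exists_radius_orthogonal hdiff hc
  obtain ⟨s, hs, hsU⟩ := Metric.nhds_basis_closedBall.mem_iff.1 (hU.mem_nhds h0)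
  refine ⟨min r s, lt_min hr hs, fun ε hε hεrs => ?_⟩
  have hεU : Metric.sphere (0 : Milnor.E m) ε ⊆ U := fun x hx =>
    hsU (Metric.closedBall_subset_closedBall (hεrs.trans (min_le_right _ _))
      (Metric.sphere_subset_closedBall hx))
  have hnz : ∀ x ∈ Metric.sphere (0 : Milnor.E m) ε, x ≠ 0 := fun x hx =>
    ne_zero_of_mem_sphere hε.ne' ⟨x, hx⟩
  refine Milnor.isSmoothFibreBundle_sphere hU hsm hε hεU (fun x hx hψx n hn => ?_)
    fun x hx hψx => ?_
  · exact Milnor.exists_orthogonal_of_eq_zero hdiff hcrit hc (hεU hx) (hnz x hx) hψx hn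
  · refine hcritr x (hεU hx) ?_ (hnz x hx) hψx
    rw [mem_sphere_zero_iff_norm.1 hx]
    exact hεrs.trans (min_le_left _ _)
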